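/- Let $(W,S)$ be a Coxeter system with length function $\ell$, set of reflections $T=\bigcup_{w\in W}wSw^{-1}$ and right descent sets $D_R(w)=\{s\in S:\ell(ws)<\ell(w)\}$. Let $W$ act on a real vector space $V$ by a geometric representation: $V$ carries a symmetric bilinear form $B$ and a family of simple roots $\Delta=\{\alpha_s\}_{s\in S}$ that is positively linearly independent (a vanishing finite linear combination with nonnegative coefficients has all coefficients $0$), with $B(\alpha_s,\alpha_s)=1$, $B(\alpha_s,\alpha_{s'})=-\cos(\pi/m_{ss'})$ if the order $m_{ss'}$ of $ss'$ is finite and $B(\alpha_s,\alpha_{s'})\le -1$ if it is infinite, and $s\in S$ acts by $s(v)=v-2B(\alpha_s,v)\alpha_s$. Let $\Phi=W(\Delta)$, $\Phi^+=\Phi\cap\operatorname{cone}(\Delta)$, $\Phi^-=-\Phi^+$, $\Phi(w)=\{\alpha\in\Phi^+: w^{-1}(\alpha)\in\Phi^-\}$ and $\operatorname{dp}(\beta)=\min\{\ell(w): w\in W,\ w(\beta)\in\Delta\}$ for $\beta\in\Phi^+$. For each $t\in T$ there is a unique $\alpha_t\in\Phi^+$ such that $t$ acts as $v\mapsto v-2B(\alpha_t,v)\alpha_t$.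 A palindromic reduced word for $t$ is a reduced word for $t$ that is a palindrome. An element $p\neq e$ of $W$ is a reflection-prefix if for every reduced word $p=s_1\cdots s_ks_{k+1}$ the word $s_1\cdots s_ks_{k+1}s_k\cdots s_1$ is a palindromic reduced word for some reflection; it is a $t$-prefix (where $t\in T$) if for every reduced word of $p$ this palindrome is a palindromic reduced word for $t$. (A) Let $t\in T$, $w\in W$ and $r\in D_R(w)$ be such that $t=wrw^{-1}$ and $\ell(t)=2\ell(w)-1$. Then $D_R(w)=\{r\}$. Moreover, if $w=s_1\cdots s_ks_{k+1}$ is a reduced word, then $s_{k+1}=r$, the word $s_1\cdots s_k\,r\,s_k\cdots s_1$ is a palindromic reduced word for $t$, and $\alpha_t=s_1\cdots s_k(\alpha_r)=-w(\alpha_r)$ with $\operatorname{dp}(\alpha_t)=k=\ell(w)-1$. (B) An element $p\in W$ is a reflection-prefix if and only if it is a $t$-prefix for exactly one reflection $t$. (C) Let $w=s_1\cdots s_kr$ be a reduced word and let $t\in T$. The following are equivalent: (1) $w$ is a $t$-prefix; (2) $s_1\cdots s_k\,r\,s_k\cdots s_1$ is a palindromic reduced word for $t$; (3) $\alpha_t=s_1\cdots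 s_k(\alpha_r)$ and $\operatorname{dp}(\alpha_t)=\ell(w)-1$. In particular, $\alpha_t\in\Phi(p)$ for every $t$-prefix $p$. (D) Let $w=s_1\cdots s_kr$ be a reduced word. The following are equivalent: $w$ is a reflection-prefix; the palindromic word $s_1\cdots s_k\,r\,s_k\cdots s_1$ is reduced; $\operatorname{dp}(s_1\cdots s_k(\alpha_r))=k$. -/

import Mathlib

/-- A geometric representation of the Coxeter system with Coxeter matrix `M`: a real vector space
`V` with a symmetric bilinear form and a positively linearly independent simple system
`(α_i)_{i ∈ B}` with the prescribed products (in `M`, the entry `0` stands for `∞`). The action of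
the Coxeter group on `V` is constructed below, see `GeometricRepresentation.rep`. -/
structure GeometricRepresentation {B : Type*} (M : CoxeterMatrix B)
    (V : Type*) [AddCommGroup V] [Module ℝ V] where
  /-- The symmetric bilinear form of the quadratic space. -/
  form : LinearMap.BilinForm ℝ V
  form_symm : ∀ u v : V, form u v = form v u
  /-- The simple roots. -/
  simpleRoot : B → V
  pos_independent : ∀ c : B →₀ ℝ, (∀ i, 0 ≤ c i) →
    Finsupp.linearCombination ℝ simpleRoot c = 0 → c = 0
  form_self : ∀ i, form (simpleRoot i) (simpleRoot i) = 1
  form_of_finite : ∀ i j, M i j ≠ 0 →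
    form (simpleRoot i) (simpleRoot j) = -Real.cos (Real.pi / (M i j : ℝ))
  form_of_infinite : ∀ i j, M i j = 0 → form (simpleRoot i) (simpleRoot j) ≤ -1

namespace GeometricRepresentation

/-- The rotation by the angle `2π / m` has order dividing `m`, as a statement on the product of
two reflections. -/
theorem reflection_mul_pow_eq_one {V : Type*} [AddCommGroup V] [Module ℝ V] (m : ℕ) (hm : 2 ≤ m)
    {x y : V} {f g : Module.Dual ℝ V} (hf : f x = 2) (hg : g y = 2)
    (hfy : f y = -2 * Real.cos (Real.pi / m)) (hgx : g x = -2 * Real.cos (Real.pi / m)) :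
    (Module.reflection hf * Module.reflection hg) ^ m = 1 := by
  ext z
  have ht : 2 * Real.cos (2 * Real.pi / m) = f y * g x - 2 := by
    rw [hfy, hgx, mul_div_assoc, Real.cos_two_mul]; ring
  rw [Module.reflection_mul_reflection_pow_apply hf hg m z _ ht]
  rcases hm.eq_or_lt with rfl | hm3
  · have h0 : Real.cos (Real.pi / (2 : ℕ)) = 0 := by simp
    have h1 : Real.cos (2 * Real.pi / (2 : ℕ)) = -1 := by
      rw [show (2 * Real.pi / ((2 : ℕ) : ℝ)) = Real.pi by push_cast; ring, Real.cos_pi]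
    rw [hfy, hgx, h0, h1]
    norm_num [Polynomial.Chebyshev.S_zero, Polynomial.Chebyshev.S_one,
      Polynomial.Chebyshev.S_neg_one]
    module
  · have hmpos : (0 : ℝ) < m := by positivity
    have hsin : Real.sin (2 * Real.pi / m) ≠ 0 := by
      refine (Real.sin_pos_of_pos_of_lt_pi (by positivity) ?_).ne'
      rw [div_lt_iff₀ hmpos]
      have : (3 : ℝ) ≤ m := by exact_mod_cast hm3
      nlinarith [Real.pi_pos]
    have hS := fun n : ℤ => Polynomial.Chebyshev.S_two_mul_real_cos (2 * Real.pi / m) n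
    rcases Nat.even_or_odd' m with ⟨k, hk | hk⟩
    · have e1 : ((m : ℤ) - 2) / 2 = k - 1 := by omega
      have e2 : ((m : ℤ) - 1) / 2 = k - 1 := by omega
      have hz : (Polynomial.Chebyshev.S ℝ ((k : ℤ) - 1)).eval
          (2 * Real.cos (2 * Real.pi / m)) = 0 := by
        refine (mul_eq_zero.mp ?_).resolve_right hsin
        rw [hS]
        have : ((((k : ℤ) - 1 : ℤ) : ℝ) + 1) * (2 * Real.pi / m) = Real.pi := by
          have : (m : ℝ) = 2 * k := by exact_mod_cast hk
          push_cast
          field_simp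
          rw [this]; ring
        rw [this, Real.sin_pi]
      rw [e1, e2, hz]
      simp
    · have e1 : ((m : ℤ) - 2) / 2 = k - 1 := by omega
      have e2 : ((m : ℤ) - 1) / 2 = k := by omega
      have e3 : ((m : ℤ) - 3) / 2 = k - 1 := by omega
      have e4 : (m : ℤ) / 2 = k := by omega
      have hz : (Polynomial.Chebyshev.S ℝ (k : ℤ)).eval (2 * Real.cos (2 * Real.pi / m)) +
          (Polynomial.Chebyshev.S ℝ ((k : ℤ) - 1)).eval
            (2 * Real.cos (2 * Real.pi / m)) = 0 := by
        refine (mul_eq_zero.mp ?_).resolve_right hsin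
        rw [add_mul, hS, hS]
        have : (((k : ℤ) : ℝ) + 1) * (2 * Real.pi / m) =
            2 * Real.pi - ((((k : ℤ) - 1 : ℤ) : ℝ) + 1) * (2 * Real.pi / m) := by
          have : (m : ℝ) = 2 * k + 1 := by exact_mod_cast hk
          push_cast
          field_simp
          rw [this]; ring
        rw [this, Real.sin_two_pi_sub]
        ring
      rw [e1, e2, e3, e4, hz]
      simp

variable {B W V : Type*} [Group W] [AddCommGroup V] [Module ℝ V] {M : CoxeterMatrix B}

theorem two_smul_form_self (G : GeometricRepresentation M V) (i : B) :
    ((2 : ℝ) • G.form (G.simpleRoot i)) (G.simpleRoot i) = 2 := by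
  simp [G.form_self i]

/-- The action of a simple reflection: `v ↦ v - 2 B(α_i, v) α_i`. -/
noncomputable def simpleReflection (G : GeometricRepresentation M V) (i : B) : V ≃ₗ[ℝ] V :=
  Module.reflection (G.two_smul_form_self i)

theorem simpleReflection_apply (G : GeometricRepresentation M V) (i : B) (v : V) :
    G.simpleReflection i v = v - (2 * G.form (G.simpleRoot i) v) • G.simpleRoot i := by
  simp [simpleReflection, Module.reflection_apply]

theorem isLiftable_simpleReflection (G : GeometricRepresentation M V) :
    M.IsLiftable G.simpleReflection := by
  intro i j
  by_cases h0 : M i j = 0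
  · rw [h0, pow_zero]
  by_cases hij : i = j
  · subst hij
    rw [M.diagonal, pow_one]
    ext v
    exact Module.involutive_reflection (G.two_smul_form_self i) v
  · have h1 : M i j ≠ 1 := M.off_diagonal i j hij
    refine reflection_mul_pow_eq_one (M i j) (by omega) _ _ ?_ ?_
    · simp [G.form_of_finite i j h0]
    · rw [LinearMap.smul_apply, G.form_symm, G.form_of_finite i j h0]
      simp

/-- The action of the Coxeter group `W` on `V`, in which the simple reflection `s_i` acts by
`v ↦ v - 2 B(α_i, v) α_i`. -/
noncomputable def rep (G : GeometricRepresentation M V) (cs : CoxeterSystem M W) :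
    W →* (V ≃ₗ[ℝ] V) :=
  cs.lift ⟨G.simpleReflection, G.isLiftable_simpleReflection⟩

theorem rep_simple_apply (G : GeometricRepresentation M V) (cs : CoxeterSystem M W) (i : B)
    (v : V) :
    G.rep cs (cs.simple i) v = v - (2 * G.form (G.simpleRoot i) v) • G.simpleRoot i := by
  rw [rep, cs.lift_apply_simple, simpleReflection_apply]

/-- The root system `Φ = W(Δ)`. -/
def roots (G : GeometricRepresentation M V) (cs : CoxeterSystem M W) : Set V :=
  {β | ∃ (w : W) (i : B), β = G.rep cs w (G.simpleRoot i)}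

/-- The cone of all finite nonnegative linear combinations of simple roots. -/
def simpleCone (G : GeometricRepresentation M V) : Set V :=
  {v | ∃ c : B →₀ ℝ, (∀ i, 0 ≤ c i) ∧ v = Finsupp.linearCombination ℝ G.simpleRoot c}

/-- The positive roots `Φ⁺ = Φ ∩ cone(Δ)`. -/
def posRoots (G : GeometricRepresentation M V) (cs : CoxeterSystem M W) : Set V :=
  G.roots cs ∩ G.simpleCone

/-- The negative roots `Φ⁻ = -Φ⁺`. -/
def negRoots (G : GeometricRepresentation M V) (cs : CoxeterSystem M W) : Set V :=
  {β | -β ∈ G.posRoots cs}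

/-- The inversion set `Φ(w)`. -/
def inversionSet (G : GeometricRepresentation M V) (cs : CoxeterSystem M W) (w : W) : Set V :=
  {β | β ∈ G.posRoots cs ∧ G.rep cs w⁻¹ β ∈ G.negRoots cs}

/-- The depth `dp(β) = min {ℓ(w) | w(β) ∈ Δ}` of a positive root `β`. -/
noncomputable def depth (G : GeometricRepresentation M V) (cs : CoxeterSystem M W) (β : V) : ℕ :=
  sInf {n | ∃ w : W, (∃ i, G.rep cs w β = G.simpleRoot i) ∧ n = cs.length w}

/-- `β` is a positive root and `t` acts on `V` as the reflection `s_β`. -/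
def IsRootOf (G : GeometricRepresentation M V) (cs : CoxeterSystem M W) (t : W) (β : V) : Prop :=
  β ∈ G.posRoots cs ∧ ∀ v, G.rep cs t v = v - (2 * G.form β v) • β

/-- The positive root `α_t` of a reflection `t`. -/
noncomputable def rootOf (G : GeometricRepresentation M V) (cs : CoxeterSystem M W) (t : W) : V :=
  Classical.epsilon (G.IsRootOf cs t)

end GeometricRepresentation

namespace CoxeterSystem

variable {B W : Type*} [Group W] {M : CoxeterMatrix B}

/-- The word `ω` is a palindromic reduced word for `t`. -/
def IsPalindromicReducedWord (cs : CoxeterSystem M W) (ω : List B) (t : W) : Prop :=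
  ω.Palindrome ∧ cs.IsReduced ω ∧ cs.wordProd ω = t

/-- `p` is a reflection-prefix: for every reduced word `s₁ ⋯ s_k s_{k+1}` of `p`, the word
`s₁ ⋯ s_k s_{k+1} s_k ⋯ s₁` is a palindromic reduced word for some reflection. The identity, which
has no reduced word of this form, is not a reflection-prefix. -/
def IsReflectionPrefix (cs : CoxeterSystem M W) (p : W) : Prop :=
  p ≠ 1 ∧ ∀ (ω : List B) (i : B), cs.IsReduced (ω ++ [i]) → cs.wordProd (ω ++ [i]) = p →
    ∃ t, cs.IsReflection t ∧ cs.IsPalindromicReducedWord (ω ++ [i] ++ ω.reverse) t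

/-- `p` is a `t`-prefix: it is a reflection-prefix, and each of its reduced words
`s₁ ⋯ s_k s_{k+1}` gives a palindromic reduced word `s₁ ⋯ s_k s_{k+1} s_k ⋯ s₁` for the
reflection `t`. -/
def IsPrefixOf (cs : CoxeterSystem M W) (t p : W) : Prop :=
  cs.IsReflection t ∧ p ≠ 1 ∧
    ∀ (ω : List B) (i : B), cs.IsReduced (ω ++ [i]) → cs.wordProd (ω ++ [i]) = p →
      cs.IsPalindromicReducedWord (ω ++ [i] ++ ω.reverse) t

end CoxeterSystem

/-! Everything rests on the formula `ℓ(t) = 2 dp(β) + 1` for a reflection `t` with positive root `β`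
(`IsRootOf.length_eq`). If `s₁⋯s_k r` is reduced and `u = s₁⋯s_k`, then `β = u(α_r)` is positive and
the palindrome is a word of `2k + 1` letters for the reflection in `β`, so it is reduced exactly
when `dp(β) = k`.

The choice of reduced word does not matter (`isRightDescent_mul_simple_iff_of_length_conj`): when
`ℓ(u r u⁻¹) = 2ℓ(u) + 1`, the only right descent of `w = u r` is `r`. Every reduced word of `w` then
ends in `r` and has the same `u`, hence the same palindromic reflection.

Both facts use the sign dichotomy: `w(α_i)` is positive or negative according as `ℓ(w s_i)` is
larger or smaller than `ℓ(w)`. It is proved by reduction to rank two, where the coefficients are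
Chebyshev values. As simple roots are only positively independent, coordinates are never compared;
pointedness of the cone replaces uniqueness of coordinates. -/

/-! ### Splitting off alternating words in two letters -/

namespace CoxeterSystem

variable {B W : Type*} [Group W] {M : CoxeterMatrix B}

/-- Descent on `ℓ(v)`: a right descent of `v` among `i, j` is moved into the alternating word. It
cannot equal the first letter of that word, since cancellation would break additivity of lengths.
The word ends in `j`, in accordance with `i` not being a descent of `w`. -/
theorem exists_eq_mul_alternatingWord_of_not_isRightDescent (cs : CoxeterSystem M W) {w : W}
    {i j : B} (hi : ¬ cs.IsRightDescent w i) (v : W) (k : ℕ)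
    (hv : w = v * cs.wordProd (alternatingWord i j k)) (hk : cs.length v + k = cs.length w) :
    ∃ (v : W) (k : ℕ), w = v * cs.wordProd (alternatingWord i j k) ∧
      cs.length v + k = cs.length w ∧ ¬ cs.IsRightDescent v i ∧ ¬ cs.IsRightDescent v j := by
  induction hn : cs.length v using Nat.strong_induction_on generalizing v k with
  | _ n ih =>
  subst hn
  have step : ∀ a, alternatingWord i j (k + 1) = a :: alternatingWord i j k →
      cs.IsRightDescent v a → ∃ (v : W) (k : ℕ), w = v * cs.wordProd (alternatingWord i j k) ∧
        cs.length v + k = cs.length w ∧ ¬ cs.IsRightDescent v i ∧ ¬ cs.IsRightDescent v j := by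
    intro a ha hd
    refine ih _ hd (v * cs.simple a) (k + 1) ?_ ?_ rfl
    · rw [ha, cs.wordProd_cons, hv]
      simp [mul_assoc]
    · have := cs.isRightDescent_iff.mp hd
      omega
  have back : ∀ a l, k = l + 1 → alternatingWord i j k = a :: alternatingWord i j l →
      ¬ cs.IsRightDescent v a := by
    intro a l hl ha hd
    have h1 : w = v * cs.simple a * cs.wordProd (alternatingWord i j l) := by
      rw [hv, ha, cs.wordProd_cons, mul_assoc]
    have h2 := cs.length_mul_le (v * cs.simple a) (cs.wordProd (alternatingWord i j l))
    have h3 := cs.length_wordProd_le (alternatingWord i j l)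
    rw [length_alternatingWord] at h3
    rw [← h1] at h2
    have : cs.length (v * cs.simple a) < cs.length v := hd
    omega
  have hs := alternatingWord_succ' i j k
  rcases k with _ | l
  · have hvw : v = w := by rw [hv]; simp [alternatingWord]
    by_cases hd : cs.IsRightDescent v j
    · exact step j (by rw [hs]; simp) hd
    · exact ⟨v, 0, hv, hk, hvw ▸ hi, hd⟩
  · have hl := alternatingWord_succ' i j l
    rcases Nat.even_or_odd l with he | ho
    · have ho' : ¬ Even (l + 1) := by simpa [Nat.even_add_one] using he
      by_cases hd : cs.IsRightDescent v i
      · exact step i (by rw [hs, if_neg ho']) hd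
      · exact ⟨v, _, hv, hk, hd, back j l rfl (by rw [hl, if_pos he])⟩
    · have ho' : ¬ Even l := Nat.not_even_iff_odd.mpr ho
      have he : Even (l + 1) := by simpa [Nat.even_add_one] using ho
      by_cases hd : cs.IsRightDescent v j
      · exact step j (by rw [hs, if_pos he]) hd
      · exact ⟨v, _, hv, hk, back i l rfl (by rw [hl, if_neg ho']), hd⟩

theorem exists_alternatingWord_add_eq_append (i j : B) (a m : ℕ) :
    ∃ X : List B, X.length = a ∧ alternatingWord i j (a + m) = X ++ alternatingWord i j m := by
  induction a with
  | zero => exact ⟨[], rfl, by simp⟩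
  | succ a ih =>
    obtain ⟨X, hX, h⟩ := ih
    refine ⟨(if Even (a + m) then j else i) :: X, by simp [hX], ?_⟩
    rw [add_right_comm, alternatingWord_succ', h, List.cons_append]

/-- Otherwise the last `M i j` letters form a braid word; the braid relation rewrites it to end in
`i`, making `i` a right descent of `w`. -/
theorem lt_of_eq_mul_alternatingWord (cs : CoxeterSystem M W) {v w : W} {i j : B} {k : ℕ}
    (hi : ¬ cs.IsRightDescent w i) (hv : w = v * cs.wordProd (alternatingWord i j k))
    (hk : cs.length v + k = cs.length w) (hm : M i j ≠ 0) : k < M i j := by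
  by_contra! hle
  obtain ⟨m, hm'⟩ := Nat.exists_eq_succ_of_ne_zero hm
  obtain ⟨a, rfl⟩ := Nat.exists_eq_add_of_le' hle
  obtain ⟨X, hX, hXw⟩ := exists_alternatingWord_add_eq_append i j a (M i j)
  have hb := cs.wordProd_braidWord_eq i j
  rw [braidWord, braidWord, M.symmetric j i, hm', alternatingWord_succ j i,
    cs.wordProd_concat] at hb
  apply hi
  have h1 : w * cs.simple i = v * cs.wordProd (X ++ alternatingWord i j m) := by
    rw [hv, hXw, cs.wordProd_append, cs.wordProd_append, hm', Nat.succ_eq_add_one, hb]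
    simp [mul_assoc]
  have h2 := cs.length_mul_le v (cs.wordProd (X ++ alternatingWord i j m))
  have h3 := cs.length_wordProd_le (X ++ alternatingWord i j m)
  rw [List.length_append, length_alternatingWord] at h3
  rw [IsRightDescent, h1]
  omega

end CoxeterSystem

/-! ### Positivity of roots via rank two -/

namespace GeometricRepresentation

variable {B W V : Type*} [Group W] [AddCommGroup V] [Module ℝ V] {M : CoxeterMatrix B}

open CoxeterSystem Polynomial

theorem form_le_zero (G : GeometricRepresentation M V) {i j : B} (hij : i ≠ j) :
    G.form (G.simpleRoot i) (G.simpleRoot j) ≤ 0 := by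
  by_cases h0 : M i j = 0
  · linarith [G.form_of_infinite i j h0]
  · have h2 : (2 : ℝ) ≤ M i j := by
      have := M.off_diagonal i j hij
      exact_mod_cast (by omega : 2 ≤ M i j)
    rw [G.form_of_finite i j h0, neg_nonpos]
    refine Real.cos_nonneg_of_neg_pi_div_two_le_of_le ?_ ?_
    · have := Real.pi_pos
      have : 0 ≤ Real.pi / M i j := by positivity
      linarith
    · exact div_le_div_of_nonneg_left Real.pi_pos.le (by norm_num) h2

theorem rep_simple_self (G : GeometricRepresentation M V) (cs : CoxeterSystem M W) (i : B) :
    G.rep cs (cs.simple i) (G.simpleRoot i) = -G.simpleRoot i := by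
  rw [rep_simple_apply, G.form_self]
  module

theorem rep_mul_apply (G : GeometricRepresentation M V) (cs : CoxeterSystem M W) (u w : W)
    (v : V) : G.rep cs (u * w) v = G.rep cs u (G.rep cs w v) := by
  rw [map_mul, LinearEquiv.mul_apply]

/-- Each further reflection changes one coefficient by the three-term recurrence of the polynomials
`U` at `-B(α_i, α_j)`. -/
theorem rep_alternatingWord_apply (G : GeometricRepresentation M V) (cs : CoxeterSystem M W)
    (i j : B) (k : ℕ) :
    G.rep cs (cs.wordProd (alternatingWord i j k)) (G.simpleRoot i) =
      (Chebyshev.U ℝ k).eval (-G.form (G.simpleRoot i) (G.simpleRoot j)) •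
          G.simpleRoot (if Even k then i else j) +
        (Chebyshev.U ℝ ((k : ℤ) - 1)).eval (-G.form (G.simpleRoot i) (G.simpleRoot j)) •
          G.simpleRoot (if Even k then j else i) := by
  induction k with
  | zero => simp [alternatingWord]
  | succ k ih =>
    have hU : Chebyshev.U ℝ ((k : ℤ) + 1) =
        2 * X * Chebyshev.U ℝ k - Chebyshev.U ℝ ((k : ℤ) - 1) := Chebyshev.U_add_one ℝ k
    rw [alternatingWord_succ', cs.wordProd_cons, rep_mul_apply, ih]
    push_cast
    rw [add_sub_cancel_right, hU]
    by_cases he : Even k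
    · have ho : ¬ Even (k + 1) := by simpa [Nat.even_add_one] using he
      simp only [he, ho, if_true, if_false, map_add, map_smul, rep_simple_apply, G.form_self,
        G.form_symm (G.simpleRoot j) (G.simpleRoot i), eval_sub, eval_mul, eval_X, eval_ofNat]
      module
    · have ho : Even (k + 1) := by simpa [Nat.even_add_one] using he
      simp only [he, ho, if_true, if_false, map_add, map_smul, rep_simple_apply, G.form_self,
        eval_sub, eval_mul, eval_X, eval_ofNat]
      module

/-- Monotonicity in the index is what carries the induction for nonnegativity. -/
theorem eval_U_nonneg_of_one_le {c : ℝ} (hc : 1 ≤ c) (k : ℕ) :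
    0 ≤ (Chebyshev.U ℝ ((k : ℤ) - 1)).eval c ∧
      (Chebyshev.U ℝ ((k : ℤ) - 1)).eval c ≤ (Chebyshev.U ℝ k).eval c := by
  induction k with
  | zero => simp
  | succ k ih =>
    have hU : Chebyshev.U ℝ ((k : ℤ) + 1) =
        2 * X * Chebyshev.U ℝ k - Chebyshev.U ℝ ((k : ℤ) - 1) := Chebyshev.U_add_one ℝ k
    push_cast
    rw [add_sub_cancel_right, hU]
    simp only [eval_sub, eval_mul, eval_X, eval_ofNat]
    refine ⟨ih.1.trans ih.2, ?_⟩
    nlinarith [ih.1, ih.2]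

/-- Here `U_n(cos θ) sin θ = sin((n + 1)θ)` with `θ = π/m`, and the bounds on `n` keep `(n + 1)θ` in
`[0, π]`. -/
theorem eval_U_cos_nonneg {m : ℕ} (hm : 2 ≤ m) {n : ℤ} (hn : -1 ≤ n) (hnm : n + 1 ≤ m) :
    0 ≤ (Chebyshev.U ℝ n).eval (Real.cos (Real.pi / m)) := by
  have h2 : (2 : ℝ) ≤ m := by exact_mod_cast hm
  have hm0 : (0 : ℝ) < m := by linarith
  have hsin : 0 < Real.sin (Real.pi / m) := by
    refine Real.sin_pos_of_pos_of_lt_pi (by positivity) ?_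
    rw [div_lt_iff₀ hm0]
    nlinarith [Real.pi_pos]
  refine nonneg_of_mul_nonneg_left ?_ hsin
  rw [Chebyshev.U_real_cos]
  have h0 : (0 : ℝ) ≤ n + 1 := by exact_mod_cast (by omega : (0 : ℤ) ≤ n + 1)
  have h1 : (n : ℝ) + 1 ≤ m := by exact_mod_cast hnm
  refine Real.sin_nonneg_of_nonneg_of_le_pi (by positivity) ?_
  rw [mul_div_assoc', div_le_iff₀ hm0]
  nlinarith [Real.pi_pos]

theorem eval_U_neg_form_nonneg (G : GeometricRepresentation M V) {i j : B} (hij : i ≠ j) (k : ℕ)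
    (hk : M i j ≠ 0 → k < M i j) :
    0 ≤ (Chebyshev.U ℝ k).eval (-G.form (G.simpleRoot i) (G.simpleRoot j)) ∧
      0 ≤ (Chebyshev.U ℝ ((k : ℤ) - 1)).eval (-G.form (G.simpleRoot i) (G.simpleRoot j)) := by
  by_cases h0 : M i j = 0
  · have h := eval_U_nonneg_of_one_le (c := -G.form (G.simpleRoot i) (G.simpleRoot j))
      (by linarith [G.form_of_infinite i j h0]) k
    exact ⟨h.1.trans h.2, h.1⟩
  · have h1 := M.off_diagonal i j hij
    have hk' := hk h0
    rw [G.form_of_finite i j h0, neg_neg]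
    exact ⟨eval_U_cos_nonneg (by omega) (by omega) (by omega),
      eval_U_cos_nonneg (by omega) (by omega) (by omega)⟩

theorem simpleRoot_mem_simpleCone (G : GeometricRepresentation M V) (i : B) :
    G.simpleRoot i ∈ G.simpleCone := by
  classical
  refine ⟨Finsupp.single i 1, fun j => ?_, by simp⟩
  rw [Finsupp.single_apply]
  split_ifs <;> norm_num

theorem add_mem_simpleCone (G : GeometricRepresentation M V) {u v : V} (hu : u ∈ G.simpleCone)
    (hv : v ∈ G.simpleCone) : u + v ∈ G.simpleCone := by
  obtain ⟨c, hc, rfl⟩ := hu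
  obtain ⟨d, hd, rfl⟩ := hv
  exact ⟨c + d, fun i => add_nonneg (hc i) (hd i), by rw [map_add]⟩

theorem smul_mem_simpleCone (G : GeometricRepresentation M V) {a : ℝ} (ha : 0 ≤ a) {v : V}
    (hv : v ∈ G.simpleCone) : a • v ∈ G.simpleCone := by
  obtain ⟨c, hc, rfl⟩ := hv
  exact ⟨a • c, fun i => mul_nonneg ha (hc i), by rw [map_smul]⟩

/-- The simple cone is pointed. -/
theorem eq_zero_of_mem_simpleCone (G : GeometricRepresentation M V) {v : V}
    (hv : v ∈ G.simpleCone) (hv' : -v ∈ G.simpleCone) : v = 0 := by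
  obtain ⟨c, hc, rfl⟩ := hv
  obtain ⟨d, hd, h⟩ := hv'
  have h0 := G.pos_independent (c + d) (fun i => add_nonneg (hc i) (hd i))
    (by rw [map_add, ← h, add_neg_cancel])
  have hc0 : c = 0 := by
    ext i
    have h1 := DFunLike.congr_fun h0 i
    simp only [Finsupp.add_apply, Finsupp.zero_apply] at h1 ⊢
    linarith [hc i, hd i]
  rw [hc0, map_zero]

/-- If `ℓ(w s_i) > ℓ(w)`, then `w(α_i)` is a nonnegative combination of simple roots. -/
theorem rep_simpleRoot_mem_simpleCone (G : GeometricRepresentation M V) (cs : CoxeterSystem M W)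
    {w : W} {i : B} (hi : ¬ cs.IsRightDescent w i) :
    G.rep cs w (G.simpleRoot i) ∈ G.simpleCone := by
  induction hn : cs.length w using Nat.strong_induction_on generalizing w i with
  | _ n ih =>
  subst hn
  by_cases hw : w = 1
  · rw [hw, map_one]
    exact G.simpleRoot_mem_simpleCone i
  obtain ⟨j, hj⟩ := cs.exists_rightDescent_of_ne_one hw
  have hij : i ≠ j := by
    rintro rfl
    exact hi hj
  obtain ⟨v, k, hv, hk, hvi, hvj⟩ := cs.exists_eq_mul_alternatingWord_of_not_isRightDescent
    (j := j) hi w 0 (by simp [alternatingWord]) rfl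
  -- `j` is a descent of `w` but not of `v`, so `v` is strictly shorter and the induction hypothesis
  -- applies to both of its simple-root images.
  have hk0 : k ≠ 0 := by
    rintro rfl
    apply hvj
    rwa [show v = w by rw [hv]; simp [alternatingWord]]
  have hlt : cs.length v < cs.length w := by omega
  have hcoef := G.eval_U_neg_form_nonneg hij k (cs.lt_of_eq_mul_alternatingWord hi hv hk)
  rw [hv, rep_mul_apply, rep_alternatingWord_apply, map_add, map_smul, map_smul]
  have key : ∀ a, a = i ∨ a = j → G.rep cs v (G.simpleRoot a) ∈ G.simpleCone := by
    rintro a (rfl | rfl)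
    · exact ih _ hlt hvi rfl
    · exact ih _ hlt hvj rfl
  exact G.add_mem_simpleCone (G.smul_mem_simpleCone hcoef.1 (key _ (by split_ifs <;> simp)))
    (G.smul_mem_simpleCone hcoef.2 (key _ (by split_ifs <;> simp)))

theorem neg_rep_simpleRoot_mem_simpleCone (G : GeometricRepresentation M V)
    (cs : CoxeterSystem M W) {w : W} {i : B} (hi : cs.IsRightDescent w i) :
    -G.rep cs w (G.simpleRoot i) ∈ G.simpleCone := by
  have h := G.rep_simpleRoot_mem_simpleCone cs
    (cs.isRightDescent_iff_not_isRightDescent_mul.mp hi)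
  rwa [rep_mul_apply, rep_simple_self, map_neg] at h

/-! ### Signs of roots and faithfulness -/

theorem form_rep_rep (G : GeometricRepresentation M V) (cs : CoxeterSystem M W) (w : W)
    (u v : V) : G.form (G.rep cs w u) (G.rep cs w v) = G.form u v := by
  induction w using cs.simple_induction_left with
  | one => simp
  | mul_simple_left w i ih =>
    rw [rep_mul_apply, rep_mul_apply, rep_simple_apply, rep_simple_apply]
    simp only [map_sub, map_smul, LinearMap.sub_apply, LinearMap.smul_apply, G.form_self,
      smul_eq_mul, ih]
    rw [G.form_symm (G.rep cs w u) (G.simpleRoot i)]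
    ring

theorem form_self_of_mem_roots (G : GeometricRepresentation M V) (cs : CoxeterSystem M W) {β : V}
    (hβ : β ∈ G.roots cs) : G.form β β = 1 := by
  obtain ⟨w, i, rfl⟩ := hβ
  rw [form_rep_rep, G.form_self]

theorem ne_zero_of_mem_roots (G : GeometricRepresentation M V) (cs : CoxeterSystem M W) {β : V}
    (hβ : β ∈ G.roots cs) : β ≠ 0 := by
  rintro rfl
  simpa using G.form_self_of_mem_roots cs hβ

theorem rep_simpleRoot_mem_simpleCone_iff (G : GeometricRepresentation M V)
    (cs : CoxeterSystem M W) {w : W} {i : B} :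
    G.rep cs w (G.simpleRoot i) ∈ G.simpleCone ↔ ¬ cs.IsRightDescent w i :=
  ⟨fun h hi => G.ne_zero_of_mem_roots cs ⟨w, i, rfl⟩
    (G.eq_zero_of_mem_simpleCone h (G.neg_rep_simpleRoot_mem_simpleCone cs hi)),
    G.rep_simpleRoot_mem_simpleCone cs⟩

theorem isRightDescent_of_neg_mem_simpleCone (G : GeometricRepresentation M V)
    (cs : CoxeterSystem M W) {w : W} {i : B}
    (h : -G.rep cs w (G.simpleRoot i) ∈ G.simpleCone) : cs.IsRightDescent w i := by
  by_contra hi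
  exact G.ne_zero_of_mem_roots cs ⟨w, i, rfl⟩
    (G.eq_zero_of_mem_simpleCone (G.rep_simpleRoot_mem_simpleCone cs hi) h)

theorem rep_injective (G : GeometricRepresentation M V) (cs : CoxeterSystem M W) :
    Function.Injective (G.rep cs) := by
  refine (injective_iff_map_eq_one _).mpr fun w hw => ?_
  by_contra hne
  obtain ⟨i, hi⟩ := cs.exists_rightDescent_of_ne_one hne
  refine (G.rep_simpleRoot_mem_simpleCone_iff cs).mp ?_ hi
  rw [hw]
  exact G.simpleRoot_mem_simpleCone i

theorem rep_mem_roots (G : GeometricRepresentation M V) (cs : CoxeterSystem M W) (w : W) {β : V}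
    (hβ : β ∈ G.roots cs) : G.rep cs w β ∈ G.roots cs := by
  obtain ⟨u, i, rfl⟩ := hβ
  exact ⟨w * u, i, by rw [rep_mul_apply]⟩

theorem mem_simpleCone_or_neg_mem_simpleCone (G : GeometricRepresentation M V)
    (cs : CoxeterSystem M W) {β : V} (hβ : β ∈ G.roots cs) :
    β ∈ G.simpleCone ∨ -β ∈ G.simpleCone := by
  obtain ⟨w, i, rfl⟩ := hβ
  by_cases hi : cs.IsRightDescent w i
  · exact Or.inr (G.neg_rep_simpleRoot_mem_simpleCone cs hi)
  · exact Or.inl (G.rep_simpleRoot_mem_simpleCone cs hi)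

theorem simpleRoot_mem_posRoots (G : GeometricRepresentation M V) (cs : CoxeterSystem M W)
    (i : B) : G.simpleRoot i ∈ G.posRoots cs :=
  ⟨⟨1, i, by simp⟩, G.simpleRoot_mem_simpleCone i⟩

/-- A simple reflection permutes the positive roots other than its own simple root. -/
theorem rep_simple_mem_posRoots (G : GeometricRepresentation M V) (cs : CoxeterSystem M W)
    {β : V} (hβ : β ∈ G.posRoots cs) {s : B} (hne : β ≠ G.simpleRoot s) :
    G.rep cs (cs.simple s) β ∈ G.posRoots cs := by
  classical
  have hroot := G.rep_mem_roots cs (cs.simple s) hβ.1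
  refine ⟨hroot, (G.mem_simpleCone_or_neg_mem_simpleCone cs hroot).resolve_right fun hneg => ?_⟩
  have hnorm := G.form_self_of_mem_roots cs hβ.1
  obtain ⟨c, hc, rfl⟩ := hβ.2
  obtain ⟨d, hd, h⟩ := hneg
  rw [rep_simple_apply] at h
  set b := G.form (G.simpleRoot s) (Finsupp.linearCombination ℝ G.simpleRoot c)
  have hsplit : ∀ f : B →₀ ℝ, Finsupp.linearCombination ℝ G.simpleRoot f =
      f s • G.simpleRoot s + Finsupp.linearCombination ℝ G.simpleRoot (f.erase s) := fun f => by
    conv_lhs => rw [← Finsupp.single_add_erase s f]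
    rw [map_add, Finsupp.linearCombination_single]
  have he : ∀ i, 0 ≤ (c + d).erase s i := fun i => by
    rw [Finsupp.erase_apply]
    split_ifs
    · exact le_rfl
    · exact add_nonneg (hc i) (hd i)
  -- Adding the expansions of `β` and `-s(β)` gives `2b α_s`; the `s`-terms are moved to one side.
  have h1 : Finsupp.linearCombination ℝ G.simpleRoot ((c + d).erase s) =
      (2 * b - (c + d) s) • G.simpleRoot s := by
    have h2 := hsplit (c + d)
    rw [map_add, ← h] at h2
    rw [sub_smul, eq_sub_iff_add_eq, add_comm, ← h2]
    module
  -- Pairing with `α_s` gives the sign, since distinct simple roots have nonpositive products.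
  -- Positive independence then kills all coefficients off `s`, so `β` is a multiple of `α_s`, equal
  -- to it by its norm.
  have h3 : 2 * b - (c + d) s ≤ 0 := by
    have h4 : G.form (G.simpleRoot s)
        (Finsupp.linearCombination ℝ G.simpleRoot ((c + d).erase s)) ≤ 0 := by
      rw [Finsupp.linearCombination_apply, map_finsuppSum]
      refine Finset.sum_nonpos fun i hi => ?_
      beta_reduce
      rw [map_smul, smul_eq_mul]
      refine mul_nonpos_of_nonneg_of_nonpos (he i) (G.form_le_zero ?_)
      rintro rfl
      simp at hi
    rwa [h1, map_smul, G.form_self, smul_eq_mul, mul_one] at h4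
  have h5 := G.pos_independent ((c + d).erase s + Finsupp.single s ((c + d) s - 2 * b))
    (fun i => by
      refine add_nonneg (he i) ?_
      rw [Finsupp.single_apply]
      split_ifs <;> linarith)
    (by rw [map_add, h1, Finsupp.linearCombination_single]; module)
  have h6 : c.erase s = 0 := by
    ext i
    by_cases hi : i = s
    · simp [hi]
    · have h7 := DFunLike.congr_fun h5 i
      simp only [Finsupp.add_apply, Finsupp.erase_ne hi, Finsupp.zero_apply,
        Finsupp.single_eq_of_ne hi] at h7 ⊢
      linarith [hc i, hd i]
  have h8 := hsplit c
  rw [h6, map_zero, add_zero] at h8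
  rw [h8] at hnorm hne
  simp only [map_smul, LinearMap.smul_apply, G.form_self, smul_eq_mul, mul_one] at hnorm
  have h9 : c s = 1 := by nlinarith [hc s]
  exact hne (by rw [h9, one_smul])

/-! ### Reflections and their positive roots -/

theorem rep_conj_apply (G : GeometricRepresentation M V) (cs : CoxeterSystem M W) {t : W} {β : V}
    (ht : ∀ v, G.rep cs t v = v - (2 * G.form β v) • β) (u : W) (v : V) :
    G.rep cs (u * t * u⁻¹) v = v - (2 * G.form (G.rep cs u β) v) • G.rep cs u β := by
  have hv : G.rep cs u (G.rep cs u⁻¹ v) = v := by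
    rw [← rep_mul_apply, mul_inv_cancel, map_one, LinearEquiv.coe_one, id]
  rw [rep_mul_apply, rep_mul_apply, ht, map_sub, map_smul, hv, ← G.form_rep_rep cs u, hv]

theorem isRootOf_conj (G : GeometricRepresentation M V) (cs : CoxeterSystem M W) {u : W} {r : B}
    (h : ¬ cs.IsRightDescent u r) :
    G.IsRootOf cs (u * cs.simple r * u⁻¹) (G.rep cs u (G.simpleRoot r)) :=
  ⟨⟨⟨u, r, rfl⟩, G.rep_simpleRoot_mem_simpleCone cs h⟩,
    G.rep_conj_apply cs (G.rep_simple_apply cs r) u⟩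

/-- `t` negates `β`, so `β` lies on the line of `γ`; unit norms leave `β = ±γ`, and pointedness of
the cone excludes the minus sign. -/
theorem IsRootOf.unique {G : GeometricRepresentation M V} {cs : CoxeterSystem M W} {t : W}
    {β γ : V} (hβ : G.IsRootOf cs t β) (hγ : G.IsRootOf cs t γ) : β = γ := by
  have hβ1 := G.form_self_of_mem_roots cs hβ.1.1
  have hγ1 := G.form_self_of_mem_roots cs hγ.1.1
  have h1 := hβ.2 β
  rw [hγ.2 β, hβ1] at h1
  have h2 : β = G.form γ β • γ := by
    have h3 : (2 : ℝ) • β = (2 : ℝ) • (G.form γ β • γ) := by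
      rw [smul_smul, eq_comm, ← sub_eq_zero]
      rw [← sub_eq_zero] at h1
      rw [← neg_eq_zero, ← h1]
      module
    exact smul_right_injective V (two_ne_zero' ℝ) h3
  have h4 : G.form γ β * G.form γ β = 1 := by
    conv_rhs => rw [← hβ1, h2]
    simp [hγ1]
  rcases mul_self_eq_one_iff.mp h4 with h5 | h5
  · rw [h2, h5, one_smul]
  · rw [h5, neg_one_smul] at h2
    exact absurd (G.eq_zero_of_mem_simpleCone hγ.1.2 (h2 ▸ hβ.1.2))
      (G.ne_zero_of_mem_roots cs hγ.1.1)

theorem existsUnique_isRootOf (G : GeometricRepresentation M V) (cs : CoxeterSystem M W) {t : W}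
    (ht : cs.IsReflection t) : ∃! β, G.IsRootOf cs t β := by
  obtain ⟨w, i, rfl⟩ := ht
  by_cases hi : cs.IsRightDescent w i
  · have h := G.isRootOf_conj cs (cs.isRightDescent_iff_not_isRightDescent_mul.mp hi)
    have hw : w * cs.simple i * cs.simple i * (w * cs.simple i)⁻¹ = w * cs.simple i * w⁻¹ := by
      simp [mul_assoc]
    rw [hw] at h
    exact ⟨_, h, fun γ hγ => hγ.unique h⟩
  · exact ⟨_, G.isRootOf_conj cs hi, fun γ hγ => hγ.unique (G.isRootOf_conj cs hi)⟩

theorem isRootOf_rootOf (G : GeometricRepresentation M V) (cs : CoxeterSystem M W) {t : W}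
    (ht : cs.IsReflection t) : G.IsRootOf cs t (G.rootOf cs t) :=
  Classical.epsilon_spec (G.existsUnique_isRootOf cs ht).exists

theorem IsRootOf.rootOf_eq {G : GeometricRepresentation M V} {cs : CoxeterSystem M W} {t : W}
    {β : V} (h : G.IsRootOf cs t β) : G.rootOf cs t = β :=
  (Classical.epsilon_spec (p := G.IsRootOf cs t) ⟨β, h⟩ : G.IsRootOf cs t _).unique h

theorem IsRootOf.eq_conj {G : GeometricRepresentation M V} {cs : CoxeterSystem M W} {t w : W}
    {i : B} (h : G.IsRootOf cs t (G.rep cs w (G.simpleRoot i))) :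
    t = w * cs.simple i * w⁻¹ := by
  refine G.rep_injective cs (LinearEquiv.ext fun v => ?_)
  rw [h.2, G.rep_conj_apply cs (G.rep_simple_apply cs i)]

/-! ### Depth of a root and length of its reflection -/

theorem depth_le (G : GeometricRepresentation M V) (cs : CoxeterSystem M W) {β : V} {w : W} {i : B}
    (h : G.rep cs w β = G.simpleRoot i) : G.depth cs β ≤ cs.length w :=
  Nat.sInf_le ⟨w, ⟨i, h⟩, rfl⟩

theorem rep_inv_apply_eq_iff (G : GeometricRepresentation M V) (cs : CoxeterSystem M W) (w : W)
    {u v : V} : G.rep cs w⁻¹ u = v ↔ u = G.rep cs w v := by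
  rw [map_inv]
  exact (G.rep cs w).symm_apply_eq

theorem exists_length_eq_depth (G : GeometricRepresentation M V) (cs : CoxeterSystem M W) {β : V}
    (hβ : β ∈ G.roots cs) :
    ∃ (w : W) (i : B), β = G.rep cs w (G.simpleRoot i) ∧ cs.length w = G.depth cs β := by
  -- Nonemptiness makes the infimum an attained minimum rather than the default `0`.
  have hne : {n | ∃ w : W, (∃ i, G.rep cs w β = G.simpleRoot i) ∧ n = cs.length w}.Nonempty := by
    obtain ⟨w, i, h⟩ := hβ
    exact ⟨_, w⁻¹, ⟨i, (G.rep_inv_apply_eq_iff cs w).mpr h⟩, rfl⟩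
  obtain ⟨w, ⟨i, hi⟩, hw⟩ := Nat.sInf_mem hne
  refine ⟨w⁻¹, i, ?_, ?_⟩
  · rw [← hi, ← rep_mul_apply, inv_mul_cancel, map_one, LinearEquiv.coe_one, id]
  · rw [cs.length_inv]
    exact hw.symm

theorem IsRootOf.rep_self {G : GeometricRepresentation M V} {cs : CoxeterSystem M W} {t : W}
    {β : V} (h : G.IsRootOf cs t β) : G.rep cs t β = -β := by
  rw [h.2, G.form_self_of_mem_roots cs h.1.1]
  module

theorem IsRootOf.length_le {G : GeometricRepresentation M V} {cs : CoxeterSystem M W} {t : W}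
    {β : V} (h : G.IsRootOf cs t β) : cs.length t ≤ 2 * G.depth cs β + 1 := by
  obtain ⟨w, i, rfl, hw⟩ := G.exists_length_eq_depth cs h.1.1
  rw [h.eq_conj]
  have h1 := cs.length_mul_le (w * cs.simple i) w⁻¹
  have h2 := cs.length_mul_le w (cs.simple i)
  rw [cs.length_inv] at h1
  rw [cs.length_simple] at h2
  omega

/-- Conjugating by a left descent `s` with `α_s ≠ β` shortens `t` by exactly two, while the depth of
the root drops by at most one. -/
theorem IsRootOf.le_length {G : GeometricRepresentation M V} {cs : CoxeterSystem M W} {t : W}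
    {β : V} (h : G.IsRootOf cs t β) : 2 * G.depth cs β + 1 ≤ cs.length t := by
  induction hn : cs.length t using Nat.strong_induction_on generalizing t β with
  | _ n ih =>
  subst hn
  have ht1 : t ≠ 1 := by
    rintro rfl
    have h1 := h.rep_self
    rw [map_one, LinearEquiv.coe_one, id] at h1
    exact G.ne_zero_of_mem_roots cs h.1.1
      (G.eq_zero_of_mem_simpleCone h.1.2 (h1 ▸ h.1.2))
  obtain ⟨s, hs⟩ := cs.exists_leftDescent_of_ne_one ht1
  have hpos : 0 < cs.length t := Nat.pos_of_ne_zero fun h0 => ht1 (cs.length_eq_zero_iff.mp h0)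
  by_cases hβs : β = G.simpleRoot s
  · have := G.depth_le cs (β := β) (w := 1) (i := s) (by simpa using hβs)
    rw [cs.length_one] at this
    omega
  have hsβ := G.rep_simple_mem_posRoots cs h.1 hβs
  have htinv : t⁻¹ = t := by
    obtain ⟨w, i, rfl⟩ := h.1.1
    exact IsReflection.inv ⟨w, i, h.eq_conj⟩
  have hts : cs.IsRightDescent t s := by
    rwa [← cs.isRightDescent_inv_iff, htinv] at hs
  have hneg := G.neg_rep_simpleRoot_mem_simpleCone cs hts
  set b := G.form β (G.simpleRoot s) with hb
  -- Otherwise `t(α_s) = α_s - 2bβ` would be positive, although `s` is a right descent of `t`.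
  have hb0 : 0 < b := by
    by_contra! hb0
    refine (G.rep_simpleRoot_mem_simpleCone_iff cs).mp ?_ hts
    rw [h.2, ← hb, sub_eq_add_neg, ← neg_smul]
    exact G.add_mem_simpleCone (G.simpleRoot_mem_simpleCone s)
      (G.smul_mem_simpleCone (by linarith) h.1.2)
  -- `st(α_s) = -(α_s + 2b s(β))` is negative, so `ℓ(sts) = ℓ(t) - 2`.
  have hsts : cs.IsRightDescent (cs.simple s * t) s := by
    apply G.isRightDescent_of_neg_mem_simpleCone cs
    rw [rep_mul_apply, h.2, ← hb, map_sub, map_smul, rep_simple_self]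
    have h2 := G.add_mem_simpleCone (G.simpleRoot_mem_simpleCone s)
      (G.smul_mem_simpleCone (by linarith : 0 ≤ 2 * b) hsβ.2)
    convert h2 using 1
    abel
  have hroot : G.IsRootOf cs (cs.simple s * t * cs.simple s)
      (G.rep cs (cs.simple s) β) := by
    refine ⟨hsβ, fun v => ?_⟩
    have := G.rep_conj_apply cs h.2 (cs.simple s) v
    rwa [cs.inv_simple] at this
  have hl1 := cs.isLeftDescent_iff.mp hs
  have hl2 := cs.isRightDescent_iff.mp hsts
  have hih := ih _ (by omega) hroot rfl
  obtain ⟨w, i, hw, hwl⟩ := G.exists_length_eq_depth cs hsβ.1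
  have h3 := G.depth_le cs (β := β) (w := w⁻¹ * cs.simple s) (i := i) (by
    rw [rep_mul_apply, G.rep_inv_apply_eq_iff, hw])
  have h4 := cs.length_mul_le w⁻¹ (cs.simple s)
  rw [cs.length_inv, cs.length_simple] at h4
  omega

/-- The length of a reflection in terms of the depth of its root. -/
theorem IsRootOf.length_eq {G : GeometricRepresentation M V} {cs : CoxeterSystem M W} {t : W}
    {β : V} (h : G.IsRootOf cs t β) : cs.length t = 2 * G.depth cs β + 1 :=
  le_antisymm h.length_le h.le_length

end GeometricRepresentation

/-! ### Palindromes and reflection-prefixes -/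

namespace CoxeterSystem

variable {B W : Type*} [Group W] {M : CoxeterMatrix B}

theorem wordProd_append_singleton_append_reverse (cs : CoxeterSystem M W) (ω : List B) (r : B) :
    cs.wordProd (ω ++ [r] ++ ω.reverse) =
      cs.wordProd ω * cs.simple r * (cs.wordProd ω)⁻¹ := by
  rw [cs.wordProd_append, cs.wordProd_append, cs.wordProd_singleton, cs.wordProd_reverse]

theorem isReflection_wordProd_palindrome (cs : CoxeterSystem M W) (ω : List B) (r : B) :
    cs.IsReflection (cs.wordProd (ω ++ [r] ++ ω.reverse)) :=
  ⟨_, r, cs.wordProd_append_singleton_append_reverse ω r⟩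

theorem isReduced_palindrome_iff (cs : CoxeterSystem M W) (ω : List B) (r : B) :
    cs.IsReduced (ω ++ [r] ++ ω.reverse) ↔
      cs.length (cs.wordProd ω * cs.simple r * (cs.wordProd ω)⁻¹) = 2 * ω.length + 1 := by
  rw [IsReduced, cs.wordProd_append_singleton_append_reverse]
  simp only [List.length_append, List.length_reverse, List.length_singleton]
  omega

theorem palindrome_append_singleton_append_reverse (ω : List B) (r : B) :
    (ω ++ [r] ++ ω.reverse).Palindrome :=
  List.Palindrome.of_reverse_eq (by simp)

theorem IsReduced.length_wordProd_of_append {cs : CoxeterSystem M W} {ω : List B} {r : B}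
    (h : cs.IsReduced (ω ++ [r])) : cs.length (cs.wordProd ω) = ω.length := by
  have := h.take ω.length
  rwa [List.take_left] at this

theorem IsReduced.not_isRightDescent_of_append {cs : CoxeterSystem M W} {ω : List B} {r : B}
    (h : cs.IsReduced (ω ++ [r])) : ¬ cs.IsRightDescent (cs.wordProd ω) r := by
  rw [not_isRightDescent_iff, h.length_wordProd_of_append]
  have := h.eq
  rwa [cs.wordProd_append, cs.wordProd_singleton, List.length_append,
    List.length_singleton] at this

theorem exists_isReduced_append_of_isRightDescent (cs : CoxeterSystem M W) {w : W} {r : B}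
    (h : cs.IsRightDescent w r) :
    ∃ ω : List B, cs.IsReduced (ω ++ [r]) ∧ cs.wordProd (ω ++ [r]) = w := by
  obtain ⟨ω, hω, hw⟩ := cs.exists_isReduced (w * cs.simple r)
  have hprod : cs.wordProd (ω ++ [r]) = w := by
    rw [cs.wordProd_append, cs.wordProd_singleton, ← hw, cs.simple_mul_simple_cancel_right]
  refine ⟨ω, ?_, hprod⟩
  rw [IsReduced, hprod, List.length_append, List.length_singleton, ← hω.eq, ← hw]
  exact (cs.isRightDescent_iff.mp h).symm

end CoxeterSystem

namespace GeometricRepresentation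

variable {B W V : Type*} [Group W] [AddCommGroup V] [Module ℝ V] {M : CoxeterMatrix B}

open CoxeterSystem

/-- A second descent `i ≠ r` of `u r` would also be a descent of `u`, because `ur(α_i) = u(α_i) -
2B(α_r, α_i) u(α_r)` is negative while its last term is nonnegative. -/
theorem isRightDescent_mul_simple_iff_of_length_conj (G : GeometricRepresentation M V)
    (cs : CoxeterSystem M W) {u : W} {r : B} (hu : ¬ cs.IsRightDescent u r)
    (hl : cs.length (u * cs.simple r * u⁻¹) = 2 * cs.length u + 1) (i : B) :
    cs.IsRightDescent (u * cs.simple r) i ↔ i = r := by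
  have hr : cs.IsRightDescent (u * cs.simple r) r := by
    rwa [isRightDescent_iff_not_isRightDescent_mul, cs.simple_mul_simple_cancel_right]
  refine ⟨fun hi => ?_, fun h => h ▸ hr⟩
  by_contra hne
  have h1 := G.neg_rep_simpleRoot_mem_simpleCone cs hi
  rw [rep_mul_apply, rep_simple_apply, map_sub, map_smul] at h1
  have h2 := G.smul_mem_simpleCone
    (by linarith [G.form_le_zero (Ne.symm hne)] :
      0 ≤ -(2 * G.form (G.simpleRoot r) (G.simpleRoot i)))
    (G.rep_simpleRoot_mem_simpleCone cs hu)
  have h3 : cs.IsRightDescent u i := by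
    apply G.isRightDescent_of_neg_mem_simpleCone cs
    convert G.add_mem_simpleCone h1 h2 using 1
    module
  have h4 := cs.isRightDescent_iff.mp h3
  have h5 := cs.isRightDescent_iff.mp hi
  have h6 := cs.not_isRightDescent_iff.mp hu
  -- This product is again `u r u⁻¹`; both factors have lost a letter, so its length is at most
  -- `2ℓ(u) - 1`.
  have h7 := cs.length_mul_le (u * cs.simple r * cs.simple i) (u * cs.simple i)⁻¹
  rw [cs.length_inv, mul_inv_rev, cs.inv_simple, ← mul_assoc,
    cs.simple_mul_simple_cancel_right] at h7
  omega

/-- If one reduced word of `w` gives a reduced palindrome, then all reduced words of `w` give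
reduced palindromes of the same reflection. -/
theorem isPalindromicReducedWord_of_wordProd_eq (G : GeometricRepresentation M V)
    (cs : CoxeterSystem M W) {ω ω' : List B} {r i : B} (h : cs.IsReduced (ω ++ [r]))
    (hp : cs.IsReduced (ω ++ [r] ++ ω.reverse)) (h' : cs.IsReduced (ω' ++ [i]))
    (heq : cs.wordProd (ω' ++ [i]) = cs.wordProd (ω ++ [r])) :
    i = r ∧ cs.wordProd ω' = cs.wordProd ω ∧ cs.IsPalindromicReducedWord (ω' ++ [i] ++ ω'.reverse)
      (cs.wordProd (ω ++ [r] ++ ω.reverse)) := by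
  have hu := h.not_isRightDescent_of_append
  have hl := (cs.isReduced_palindrome_iff ω r).mp hp
  have hi : cs.IsRightDescent (cs.wordProd ω * cs.simple r) i := by
    rw [cs.wordProd_append ω, cs.wordProd_singleton] at heq
    rw [← heq, cs.wordProd_append, cs.wordProd_singleton,
      isRightDescent_iff_not_isRightDescent_mul, cs.simple_mul_simple_cancel_right]
    exact h'.not_isRightDescent_of_append
  rw [← h.length_wordProd_of_append] at hl
  obtain rfl := (G.isRightDescent_mul_simple_iff_of_length_conj cs hu hl i).mp hi
  have hω : cs.wordProd ω' = cs.wordProd ω := by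
    simpa only [cs.wordProd_append, cs.wordProd_singleton, mul_left_inj] using heq
  refine ⟨rfl, hω, palindrome_append_singleton_append_reverse ω' i, ?_, ?_⟩
  · rw [isReduced_palindrome_iff, hω, hl, ← hω, h'.length_wordProd_of_append]
  · rw [wordProd_append_singleton_append_reverse, wordProd_append_singleton_append_reverse, hω]

theorem isPrefixOf_of_isReduced_palindrome (G : GeometricRepresentation M V)
    (cs : CoxeterSystem M W) {ω : List B} {r : B} (h : cs.IsReduced (ω ++ [r]))
    (hp : cs.IsReduced (ω ++ [r] ++ ω.reverse)) :
    cs.IsPrefixOf (cs.wordProd (ω ++ [r] ++ ω.reverse)) (cs.wordProd (ω ++ [r])) := by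
  refine ⟨cs.isReflection_wordProd_palindrome ω r, fun h1 => ?_, fun ω' i h' heq =>
    (G.isPalindromicReducedWord_of_wordProd_eq cs h hp h' heq).2.2⟩
  have := h.eq
  rw [h1, cs.length_one, List.length_append, List.length_singleton] at this
  omega

theorem isRootOf_wordProd_palindrome (G : GeometricRepresentation M V) (cs : CoxeterSystem M W)
    {ω : List B} {r : B} (h : cs.IsReduced (ω ++ [r])) :
    G.IsRootOf cs (cs.wordProd (ω ++ [r] ++ ω.reverse))
      (G.rep cs (cs.wordProd ω) (G.simpleRoot r)) := by
  rw [wordProd_append_singleton_append_reverse]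
  exact G.isRootOf_conj cs h.not_isRightDescent_of_append

theorem isReduced_palindrome_iff_depth (G : GeometricRepresentation M V) (cs : CoxeterSystem M W)
    {ω : List B} {r : B} (h : cs.IsReduced (ω ++ [r])) :
    cs.IsReduced (ω ++ [r] ++ ω.reverse) ↔
      G.depth cs (G.rep cs (cs.wordProd ω) (G.simpleRoot r)) = ω.length := by
  have := (G.isRootOf_wordProd_palindrome cs h).length_eq
  rw [wordProd_append_singleton_append_reverse] at this
  rw [isReduced_palindrome_iff]
  omega

end GeometricRepresentation

namespace CoxeterSystem

variable {B W : Type*} [Group W] {M : CoxeterMatrix B}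

theorem exists_isReduced_append_of_ne_one (cs : CoxeterSystem M W) {p : W} (hp : p ≠ 1) :
    ∃ (ω : List B) (i : B), cs.IsReduced (ω ++ [i]) ∧ cs.wordProd (ω ++ [i]) = p := by
  obtain ⟨i, hi⟩ := cs.exists_rightDescent_of_ne_one hp
  obtain ⟨ω, h⟩ := cs.exists_isReduced_append_of_isRightDescent hi
  exact ⟨ω, i, h⟩

theorem IsPrefixOf.isReflectionPrefix {cs : CoxeterSystem M W} {t p : W}
    (h : cs.IsPrefixOf t p) : cs.IsReflectionPrefix p :=
  ⟨h.2.1, fun ω i hω hp => ⟨t, h.1, h.2.2 ω i hω hp⟩⟩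

/-- As `p ≠ 1`, some reduced word exists, and its palindrome evaluates to both reflections. -/
theorem IsPrefixOf.unique {cs : CoxeterSystem M W} {t t' p : W} (h : cs.IsPrefixOf t p)
    (h' : cs.IsPrefixOf t' p) : t = t' := by
  obtain ⟨ω, i, hω, hp⟩ := cs.exists_isReduced_append_of_ne_one h.2.1
  exact (h.2.2 ω i hω hp).2.2.symm.trans (h'.2.2 ω i hω hp).2.2

end CoxeterSystem

/-! ### The main theorem -/

theorem mainTheorem6 {B W V : Type*} [Group W] [AddCommGroup V] [Module ℝ V]
    {M : CoxeterMatrix B} (cs : CoxeterSystem M W) (G : GeometricRepresentation M V) :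
    -- every reflection has exactly one positive root
    (∀ t : W, cs.IsReflection t → ∃! β : V, G.IsRootOf cs t β) ∧
    -- the proposition
    (∀ (t w : W) (r : B), cs.IsReflection t → cs.IsRightDescent w r →
      t = w * cs.simple r * w⁻¹ → cs.length t + 1 = 2 * cs.length w →
        (∀ i : B, cs.IsRightDescent w i ↔ i = r) ∧
        (∀ (ω : List B) (i : B), cs.IsReduced (ω ++ [i]) → cs.wordProd (ω ++ [i]) = w →
          i = r ∧ cs.IsPalindromicReducedWord (ω ++ [r] ++ ω.reverse) t ∧
          G.rootOf cs t = G.rep cs (cs.wordProd ω) (G.simpleRoot r) ∧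
          G.depth cs (G.rootOf cs t) = ω.length) ∧
        G.rootOf cs t = -G.rep cs w (G.simpleRoot r) ∧
        G.depth cs (G.rootOf cs t) + 1 = cs.length w) ∧
    -- a reflection-prefix is a prefix of exactly one reflection
    (∀ p : W, cs.IsReflectionPrefix p ↔ ∃! t : W, cs.IsPrefixOf t p) ∧
    -- the corollary, for a given reflection
    (∀ (t w : W) (ω : List B) (r : B), cs.IsReflection t → cs.IsReduced (ω ++ [r]) →
      cs.wordProd (ω ++ [r]) = w →
        [cs.IsPrefixOf t w,
          cs.IsPalindromicReducedWord (ω ++ [r] ++ ω.reverse) t,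
          G.rootOf cs t = G.rep cs (cs.wordProd ω) (G.simpleRoot r) ∧
            G.depth cs (G.rootOf cs t) + 1 = cs.length w].TFAE) ∧
    (∀ t p : W, cs.IsPrefixOf t p → G.rootOf cs t ∈ G.inversionSet cs p) ∧
    -- the equivalence without reference to a given reflection
    (∀ (ω : List B) (r : B), cs.IsReduced (ω ++ [r]) →
        [cs.IsReflectionPrefix (cs.wordProd (ω ++ [r])),
          cs.IsReduced (ω ++ [r] ++ ω.reverse),
          G.depth cs (G.rep cs (cs.wordProd ω) (G.simpleRoot r)) = ω.length].TFAE) := by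
  have hmain : ∀ (w : W) (ω : List B) (r : B), cs.IsReduced (ω ++ [r]) →
      cs.wordProd (ω ++ [r]) = w →
        G.rep cs (cs.wordProd ω) (G.simpleRoot r) = -G.rep cs w (G.simpleRoot r) := by
    rintro _ ω r - rfl
    rw [cs.wordProd_append, cs.wordProd_singleton, G.rep_mul_apply, G.rep_simple_self, map_neg,
      neg_neg]
  refine ⟨fun t ht => G.existsUnique_isRootOf cs ht, ?_, ?_, ?_, ?_, ?_⟩
  · intro t w r ht hr htw hl
    obtain ⟨ω, hω, hw⟩ := cs.exists_isReduced_append_of_isRightDescent hr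
    have hpal : cs.wordProd (ω ++ [r] ++ ω.reverse) = t := by
      rw [htw, ← hw, cs.wordProd_append_singleton_append_reverse, cs.wordProd_append,
        cs.wordProd_singleton]
      simp [mul_assoc]
    have hwl : cs.length w = ω.length + 1 := by
      rw [← hw, hω.eq, List.length_append, List.length_singleton]
    have hred : cs.IsReduced (ω ++ [r] ++ ω.reverse) := by
      rw [cs.isReduced_palindrome_iff, ← cs.wordProd_append_singleton_append_reverse, hpal]
      omega
    have hroot := (G.isRootOf_wordProd_palindrome cs hω).rootOf_eq
    have hdep := (G.isReduced_palindrome_iff_depth cs hω).mp hred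
    rw [hpal] at hroot
    rw [← hroot] at hdep
    refine ⟨fun i => ⟨fun hi => ?_, fun h => h ▸ hr⟩, fun ω' i hω' hw' => ?_, ?_, ?_⟩
    · obtain ⟨ω', hω', hw'⟩ := cs.exists_isReduced_append_of_isRightDescent hi
      exact (G.isPalindromicReducedWord_of_wordProd_eq cs hω hred hω' (hw'.trans hw.symm)).1
    · obtain ⟨rfl, h1, h2⟩ :=
        G.isPalindromicReducedWord_of_wordProd_eq cs hω hred hω' (hw'.trans hw.symm)
      rw [hpal] at h2
      exact ⟨rfl, h2, by rw [hroot, h1], by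
        rw [hdep, ← hω.length_wordProd_of_append, ← h1, hω'.length_wordProd_of_append]⟩
    · rw [hroot, hmain w ω r hω hw]
    · rw [hdep, hwl]
  · intro p
    refine ⟨fun h => ?_, fun ⟨t, ht, _⟩ => ht.isReflectionPrefix⟩
    obtain ⟨ω, i, hω, rfl⟩ := cs.exists_isReduced_append_of_ne_one h.1
    obtain ⟨_, _, hp⟩ := h.2 ω i hω rfl
    have ht := G.isPrefixOf_of_isReduced_palindrome cs hω hp.2.1
    exact ⟨_, ht, fun t' ht' => ht'.unique ht⟩
  · rintro t _ ω r ht hω rfl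
    tfae_have 1 → 2 := fun h => h.2.2 ω r hω rfl
    tfae_have 2 → 1 := by
      rintro ⟨_, h2, rfl⟩
      exact G.isPrefixOf_of_isReduced_palindrome cs hω h2
    tfae_have 2 → 3 := by
      rintro ⟨_, h2, rfl⟩
      rw [(G.isRootOf_wordProd_palindrome cs hω).rootOf_eq,
        (G.isReduced_palindrome_iff_depth cs hω).mp h2, hω.eq, List.length_append,
        List.length_singleton]
      exact ⟨rfl, rfl⟩
    tfae_have 3 → 2 := by
      rintro ⟨h1, h2⟩
      -- By faithfulness, the root determines `t` as the conjugate spelled by the palindrome.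
      have h3 := G.isRootOf_rootOf cs ht
      rw [h1] at h2 h3
      rw [hω.eq, List.length_append, List.length_singleton, Nat.add_right_cancel_iff] at h2
      exact ⟨CoxeterSystem.palindrome_append_singleton_append_reverse ω r,
        (G.isReduced_palindrome_iff_depth cs hω).mpr h2,
        (cs.wordProd_append_singleton_append_reverse ω r).trans h3.eq_conj.symm⟩
    tfae_finish
  · intro t p h
    obtain ⟨ω, r, hω, hp⟩ := cs.exists_isReduced_append_of_ne_one h.2.1
    obtain ⟨_, _, rfl⟩ := h.2.2 ω r hω hp
    have hroot := G.isRootOf_wordProd_palindrome cs hω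
    rw [hroot.rootOf_eq]
    refine ⟨hroot.1, ?_⟩
    rw [hmain p ω r hω hp, map_neg, (G.rep_inv_apply_eq_iff cs p).mpr rfl]
    change - -G.simpleRoot r ∈ G.posRoots cs
    rw [neg_neg]
    exact G.simpleRoot_mem_posRoots cs r
  · intro ω r hω
    tfae_have 1 → 2 := fun h => by
      obtain ⟨_, _, hp⟩ := h.2 ω r hω rfl
      exact hp.2.1
    tfae_have 2 → 1 := fun h =>
      (G.isPrefixOf_of_isReduced_palindrome cs hω h).isReflectionPrefix
    tfae_have 2 ↔ 3 := G.isReduced_palindrome_iff_depth cs hω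
    tfae_finish
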